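/- Fix integers $d\ge n\ge 1$ and a matrix $X\in\mathbb R^{n\times d}$ of full row rank $n$. Let $\pi$ be a probability measure on $\mathbb R^d$ with mean zero (and $\mathbb E_\pi\|\theta\|<\infty$) such that, for $\theta\sim\pi$, the vector $X\theta$ has a density $p$ on $\mathbb R^n$ that is everywhere positive and differentiable. Put $$\mathsf J_\pi=\mathbb E_{\theta\sim\pi}\Big[\tfrac1n\|\nabla\log p(X\theta)\|^2\Big],\qquad \mathsf V_\pi=\mathbb E_{\theta\sim\pi}\Big[\tfrac1n\|X\theta\|^2\Big],$$ and assume that both are positive and finite. For $\sigma>0$ let $y=X\theta+\sigma\tau$, where $\theta\sim\pi$ and $\tau\sim\mathcal N(0,I_n)$ are independent. Let $\hat\theta_B(y)=\mathbb E[\theta\mid y]$ be the Bayes estimator, and let $\mathsf{Train}(\hat\theta_B)=\mathbb E\big[\tfrac1n\|X\hat\theta_B(y)-y\|^2\big]$ be its expected training error. Then for every $\sigma^2>0$ $$\frac{\sigma^4}{\mathsf V_\pi+\sigma^2}\le \mathsf{Train}(\hat\theta_B)\le \frac{\sigma^4}{\mathsf J_\pi^{-1}+\sigma^2}.$$ Moreover,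 for fixed $n,d,X,\pi$, $$\mathsf{Train}(\hat\theta_B)=\frac{\sigma^4}{\mathsf J_\pi^{-1}+\sigma^2}+o(\sigma^4)=\mathsf J_\pi\sigma^4+o(\sigma^4)\quad\text{as }\sigma^2\to0,$$ $$\mathsf{Train}(\hat\theta_B)=\frac{\sigma^4}{\mathsf V_\pi+\sigma^2}+o(1)=\sigma^2-\mathsf V_\pi+o(1)\quad\text{as }\sigma^2\to\infty.$$ -/

import Mathlib

open MeasureTheory ProbabilityTheory Filter Topology Asymptotics

noncomputable section

namespace BayesTrain

/-- The joint law of `(θ, τ)`: the coefficients `θ ∼ π` and the standardized noise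
`τ ∼ N(0, I_n)` are independent. -/
def model {d : ℕ} (n : ℕ) (π : Measure (EuclideanSpace ℝ (Fin d))) :
    Measure (EuclideanSpace ℝ (Fin d) × EuclideanSpace ℝ (Fin n)) :=
  π.prod (stdGaussian (EuclideanSpace ℝ (Fin n)))

instance {d n : ℕ} (π : Measure (EuclideanSpace ℝ (Fin d))) [IsProbabilityMeasure π] :
    IsProbabilityMeasure (model n π) := by
  unfold model; infer_instance

/-- The observed response `y = X θ + σ τ`. -/
def response {n d : ℕ} (X : Matrix (Fin n) (Fin d) ℝ) (σ : ℝ)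
    (ω : EuclideanSpace ℝ (Fin d) × EuclideanSpace ℝ (Fin n)) : EuclideanSpace ℝ (Fin n) :=
  X.toEuclideanLin ω.1 + σ • ω.2

/-- The training error `E [(1/n) ‖X θ̂(y) - y‖²]` of an estimator `θ̂`, which is a function of
the response `y`, at noise level `σ²`. -/
def trainError {n d : ℕ} (X : Matrix (Fin n) (Fin d) ℝ)
    (π : Measure (EuclideanSpace ℝ (Fin d))) (σ : ℝ)
    (est : EuclideanSpace ℝ (Fin n) → EuclideanSpace ℝ (Fin d)) : ℝ :=
  ∫ ω, (1 / (n : ℝ)) * ‖X.toEuclideanLin (est (response X σ ω)) - response X σ ω‖ ^ 2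
    ∂(model n π)

/-- The Bayes estimator `y ↦ E [θ | y]`: the mean of the posterior distribution, that is, of
the regular conditional distribution of `θ` given the response `y`. -/
def bayesEstimator {n d : ℕ} (X : Matrix (Fin n) (Fin d) ℝ)
    (π : Measure (EuclideanSpace ℝ (Fin d))) [IsProbabilityMeasure π] (σ : ℝ)
    (y : EuclideanSpace ℝ (Fin n)) : EuclideanSpace ℝ (Fin d) :=
  ∫ θ, θ ∂(condDistrib Prod.fst (response X σ) (model n π) y)

/-- The integrand `(1/n) ‖∇ log p (X θ)‖²` of the Fisher information. -/
def scoreSq {n d : ℕ} (X : Matrix (Fin n) (Fin d) ℝ) (p : EuclideanSpace ℝ (Fin n) → ℝ)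
    (θ : EuclideanSpace ℝ (Fin d)) : ℝ :=
  (1 / (n : ℝ)) * ‖gradient (fun y => Real.log (p y)) (X.toEuclideanLin θ)‖ ^ 2

/-- The Fisher information parameter `J_π = E [(1/n) ‖∇ log p (X θ)‖²]`, where `p` is the
density of `X θ`. -/
def fisherInfo {n d : ℕ} (X : Matrix (Fin n) (Fin d) ℝ)
    (π : Measure (EuclideanSpace ℝ (Fin d))) (p : EuclideanSpace ℝ (Fin n) → ℝ) : ℝ :=
  ∫ θ, scoreSq X p θ ∂π

/-- The integrand `(1/n) ‖X θ‖²` of the variance parameter. -/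
def signalSq {n d : ℕ} (X : Matrix (Fin n) (Fin d) ℝ) (θ : EuclideanSpace ℝ (Fin d)) : ℝ :=
  (1 / (n : ℝ)) * ‖X.toEuclideanLin θ‖ ^ 2

/-- The variance parameter `V_π = E [(1/n) ‖X θ‖²]`. -/
def varParam {n d : ℕ} (X : Matrix (Fin n) (Fin d) ℝ)
    (π : Measure (EuclideanSpace ℝ (Fin d))) : ℝ :=
  ∫ θ, signalSq X θ ∂π

end BayesTrain

end

/-!
Write `u = X θ`, with density `p` and law `μ`, let `τ` be the standardized noise, `y = u + σ τ`
and `s = ∇ log p`. Since `X θ̂(y) = 𝔼[u | y]` and `y = 𝔼[u | y] + σ 𝔼[τ | y]`, the training error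
is `(σ² / n) 𝔼 ‖𝔼[τ | y]‖²` (`trainError_bayesEstimator`), and the question is how well the noise
is predicted by the observation.

*Lower bound.* Conditional expectation is the orthogonal projection in `L²`, so it predicts `τ` at
least as well as any multiple of `y` does; the regression coefficient `σ / (V + σ²)` gives
`σ⁴ / (V + σ²)` (`GaussianChannel.le_integral_norm_condExp_noise_sq`).

*Upper bound.* Tweedie's formula `𝔼[τ + σ s(u) | y] = 0` holds because, tested against a smooth
compactly supported function of `y`, Gaussian integration by parts in `τ` and integration by parts
against `p` in `u` produce the same term (`GaussianChannel.condExp_noise_add_score`). For the second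
one it is enough that `p` is differentiable everywhere with integrable gradient. So `τ` and
`(1 - a) τ - a σ s(u)` have the same posterior mean for every `a`. The second moment of the latter
is explicit, `τ` being centred and independent of `u`, and `a = 1 / (1 + σ² J)` gives
`σ⁴ / (J⁻¹ + σ²)` (`GaussianChannel.integral_norm_condExp_noise_sq_le`).

*Small noise.* By Tweedie's formula the training error is `(σ⁴ / n) 𝔼 ‖𝔼[s(u) | y]‖²`. If `g` is
bounded, continuous and close to `s` in `L²(μ)`, then `g(y)` is close to `g(u)`, so `y` predicts
`s(u)` with vanishing error (`GaussianChannel.tendsto_integral_norm_condExp_sq_zero`).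

*Large noise.* The Pythagorean identity turns the training error into
`σ² - V + (1 / n) 𝔼 ‖𝔼[u | y]‖²`. The last term tends to zero: for bounded centred `g` the quantity
`𝔼 ‖𝔼[g(u) | y]‖²` is the expectation of the inner product of `g(u)` with a bounded function of
`τ + u / σ`. Replacing `τ + u / σ` by `τ` would make it vanish, and costs the `L¹` distance between
the Gaussian density and its translate by `u / σ`
(`GaussianChannel.tendsto_integral_norm_condExp_sq_atTop`).
-/

noncomputable section

namespace BayesTrain

open scoped RealInnerProductSpace

/-! ### The standard Gaussian density -/

section Gaussian

variable {E : Type*} [NormedAddCommGroup E] [InnerProductSpace ℝ E]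

/-- The density `(2π)^(-dim E / 2) exp (-‖x‖² / 2)` of the standard Gaussian distribution. -/
def gaussianDensity (x : E) : ℝ :=
  (2 * Real.pi) ^ (-(Module.finrank ℝ E / 2 : ℝ)) * Real.exp (-(1 / 2) * ‖x‖ ^ 2)

lemma gaussianDensity_pos (x : E) : 0 < gaussianDensity x := by
  unfold gaussianDensity; positivity

@[fun_prop]
lemma continuous_gaussianDensity : Continuous (gaussianDensity : E → ℝ) := by
  unfold gaussianDensity; fun_prop

lemma hasFDerivAt_gaussianDensity (x : E) :
    HasFDerivAt gaussianDensity (-(gaussianDensity x) • innerSL ℝ x) x := by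
  have h := ((((hasStrictFDerivAt_norm_sq x).hasFDerivAt.const_mul
    (-(1 / 2) : ℝ)).exp).const_mul ((2 * Real.pi) ^ (-(Module.finrank ℝ E / 2 : ℝ))))
  refine h.congr_fderiv ?_
  ext v
  simp [gaussianDensity]
  ring

variable [FiniteDimensional ℝ E] [MeasurableSpace E] [BorelSpace E]

lemma integrable_exp_neg_mul_sq_norm {b : ℝ} (hb : 0 < b) :
    Integrable (fun x : E => Real.exp (-b * ‖x‖ ^ 2)) := by
  have h := (GaussianFourier.integrable_cexp_neg_mul_sq_norm_add (V := E) (b := b)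
    (by simpa using hb) 0 0).re
  refine h.congr (ae_of_all _ fun x => ?_)
  simp only [zero_mul, add_zero, RCLike.re_eq_complex_re]
  rw [← Complex.ofReal_re (Real.exp (-b * ‖x‖ ^ 2))]
  push_cast
  rfl

lemma integrable_gaussianDensity : Integrable (gaussianDensity : E → ℝ) :=
  (integrable_exp_neg_mul_sq_norm (by norm_num : (0 : ℝ) < 1 / 2)).const_mul _

lemma integral_gaussianDensity : ∫ x : E, gaussianDensity x = 1 := by
  unfold gaussianDensity
  rw [integral_const_mul, GaussianFourier.integral_rexp_neg_mul_sq_norm (by norm_num),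
    div_div_eq_mul_div, div_one, mul_comm Real.pi, ← Real.rpow_add (by positivity)]
  simp

/-- The characteristic function determines the measure, so comparing Fourier transforms
identifies the density. -/
lemma stdGaussian_eq_withDensity :
    stdGaussian E = volume.withDensity (fun x => ENNReal.ofReal (gaussianDensity x)) := by
  have hfin : IsFiniteMeasure
      ((volume : Measure E).withDensity (fun x => ENNReal.ofReal (gaussianDensity x))) :=
    isFiniteMeasure_withDensity_ofReal integrable_gaussianDensity.2
  refine Measure.ext_of_charFun ?_
  ext t
  rw [charFun_stdGaussian, charFun_apply,
    integral_withDensity_eq_integral_toReal_smul (by fun_prop) (by simp)]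
  have h1 : ∀ x : E, (ENNReal.ofReal (gaussianDensity x)).toReal •
      Complex.exp (⟪x, t⟫ * Complex.I) = ((2 * Real.pi) ^ (-(Module.finrank ℝ E / 2 : ℝ)) : ℝ) *
        Complex.exp (-((1 / 2 : ℝ) : ℂ) * ‖x‖ ^ 2 + Complex.I * ⟪t, x⟫) := by
    intro x
    rw [ENNReal.toReal_ofReal (gaussianDensity_pos x).le, Complex.exp_add, gaussianDensity,
      real_inner_comm, Complex.real_smul]
    push_cast
    ring_nf
  simp_rw [h1]
  rw [integral_const_mul,
    GaussianFourier.integral_cexp_neg_mul_sq_norm_add (by norm_num) Complex.I t, ← mul_assoc]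
  have h2 : (((2 * Real.pi) ^ (-(Module.finrank ℝ E / 2 : ℝ)) : ℝ) : ℂ) *
      (Real.pi / ((1 / 2 : ℝ) : ℂ)) ^ (Module.finrank ℝ E / 2 : ℂ) = 1 := by
    have : ((Real.pi : ℂ) / ((1 / 2 : ℝ) : ℂ)) ^ (Module.finrank ℝ E / 2 : ℂ)
        = (((2 * Real.pi) ^ (Module.finrank ℝ E / 2 : ℝ) : ℝ) : ℂ) := by
      rw [Complex.ofReal_cpow (by positivity)]
      push_cast
      congr 1
      ring
    rw [this, ← Complex.ofReal_mul, ← Real.rpow_add (by positivity)]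
    simp
  rw [h2, one_mul]
  congr 1
  simp
  ring

lemma integral_stdGaussian {F : Type*} [NormedAddCommGroup F] [NormedSpace ℝ F] (f : E → F) :
    ∫ x, f x ∂(stdGaussian E) = ∫ x, gaussianDensity x • f x := by
  rw [stdGaussian_eq_withDensity,
    integral_withDensity_eq_integral_toReal_smul (by fun_prop) (by simp)]
  simp_rw [ENNReal.toReal_ofReal (gaussianDensity_pos _).le]

/-- Gaussian integration by parts (Stein's identity). -/
lemma integral_inner_mul_stdGaussian {h : E → ℝ} (hh : ContDiff ℝ 1 h)
    (hc : HasCompactSupport h) (v : E) :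
    ∫ x, ⟪x, v⟫ * h x ∂(stdGaussian E) = ∫ x, fderiv ℝ h x v ∂(stdGaussian E) := by
  have hdc : HasCompactSupport (fun x => fderiv ℝ h x v) := hc.fderiv_apply ℝ v
  have hdcont : Continuous (fun x => fderiv ℝ h x v) := by
    have := hh.continuous_fderiv one_ne_zero
    fun_prop
  have hfd : ∀ x : E, fderiv ℝ gaussianDensity x v = -(gaussianDensity x * ⟪x, v⟫) := fun x => by
    rw [(hasFDerivAt_gaussianDensity x).fderiv]; simp
  have hcont := hh.continuous
  have key := integral_mul_fderiv_eq_neg_fderiv_mul_of_integrable (𝕜 := ℝ) (μ := volume)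
    (f := (gaussianDensity : E → ℝ)) (g := h) (v := v)
    (by
      simp_rw [hfd]
      exact Continuous.integrable_of_hasCompactSupport (by fun_prop) hc.mul_left)
    (Continuous.integrable_of_hasCompactSupport (by fun_prop) hdc.mul_left)
    (Continuous.integrable_of_hasCompactSupport (by fun_prop) hc.mul_left)
    (fun x _ => (hasFDerivAt_gaussianDensity x).differentiableAt)
    (fun x _ => (hh.differentiable one_ne_zero) x)
  simp_rw [integral_stdGaussian, smul_eq_mul]
  rw [key, ← integral_neg]
  refine integral_congr_ae (ae_of_all _ fun x => ?_)
  simp only [hfd]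
  ring

lemma memLp_two_id_stdGaussian : MemLp (fun x : E => x) 2 (stdGaussian E) :=
  IsGaussian.memLp_two_id

lemma integral_norm_sq_stdGaussian :
    ∫ x : E, ‖x‖ ^ 2 ∂(stdGaussian E) = Module.finrank ℝ E := by
  let b := stdOrthonormalBasis ℝ E
  have h : ∀ i, ∫ x : E, ⟪b i, x⟫ ^ 2 ∂(stdGaussian E) = 1 := fun i => by
    have h1 := variance_dual_stdGaussian (innerSL ℝ (b i))
    rw [variance_eq_integral (by fun_prop), integral_strongDual_stdGaussian] at h1
    simpa using h1
  simp_rw [← b.sum_sq_inner_right]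
  rw [integral_finsetSum]
  · simp [h]
  · intro i _
    exact (memLp_two_id_stdGaussian.const_inner (b i)).integrable_sq

/-- The `L¹` distance between the standard Gaussian density and its translate by `w`. -/
def gaussianShift (w : E) : ℝ := ∫ z : E, |gaussianDensity (z - w) - gaussianDensity z|

lemma integrable_gaussianShift (w : E) :
    Integrable (fun z : E => |gaussianDensity (z - w) - gaussianDensity z|) :=
  ((integrable_gaussianDensity.comp_sub_right w).sub integrable_gaussianDensity).abs

lemma stronglyMeasurable_gaussianShift : StronglyMeasurable (gaussianShift : E → ℝ) := by
  have hc : Continuous fun z : E × E => |gaussianDensity (z.2 - z.1) - gaussianDensity z.2| := by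
    fun_prop
  exact hc.stronglyMeasurable.integral_prod_right

lemma gaussianShift_nonneg (w : E) : 0 ≤ gaussianShift w :=
  integral_nonneg fun _ => abs_nonneg _

lemma gaussianShift_le_two (w : E) : gaussianShift w ≤ 2 := by
  calc gaussianShift w
      ≤ ∫ z : E, (gaussianDensity (z - w) + gaussianDensity z) := by
        refine integral_mono (integrable_gaussianShift w)
          ((integrable_gaussianDensity.comp_sub_right w).add integrable_gaussianDensity)
          fun z => ?_
        have h1 := gaussianDensity_pos z
        have h2 := gaussianDensity_pos (z - w)
        exact abs_le.2 ⟨by linarith, by linarith⟩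
    _ = 2 := by
        rw [integral_add (integrable_gaussianDensity.comp_sub_right w) integrable_gaussianDensity,
          integral_sub_right_eq_self (gaussianDensity : E → ℝ), integral_gaussianDensity]
        norm_num

lemma tendsto_gaussianShift : Tendsto (gaussianShift : E → ℝ) (𝓝 0) (𝓝 0) := by
  have hc : (0 : ℝ) ≤ (2 * Real.pi) ^ (-(Module.finrank ℝ E / 2 : ℝ)) := by positivity
  have h := tendsto_integral_filter_of_dominated_convergence (μ := (volume : Measure E))
    (l := 𝓝 (0 : E)) (F := fun w z => |gaussianDensity (z - w) - gaussianDensity z|)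
    (f := fun _ => (0 : ℝ))
    (fun z => (2 * Real.pi) ^ (-(Module.finrank ℝ E / 2 : ℝ)) *
      (Real.exp (1 / 2) * Real.exp (-(1 / 4) * ‖z‖ ^ 2)) + gaussianDensity z)
    (Eventually.of_forall fun w => (integrable_gaussianShift w).aestronglyMeasurable)
    ?_ ?_ ?_
  · simp only [integral_zero] at h
    exact h
  · filter_upwards [Metric.ball_mem_nhds (0 : E) one_pos] with w hw
    refine ae_of_all _ fun z => ?_
    rw [mem_ball_zero_iff] at hw
    rw [Real.norm_eq_abs, abs_abs]
    have h1 := gaussianDensity_pos z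
    have h2 := gaussianDensity_pos (z - w)
    have h3 : gaussianDensity (z - w) ≤ (2 * Real.pi) ^ (-(Module.finrank ℝ E / 2 : ℝ)) *
      (Real.exp (1 / 2) * Real.exp (-(1 / 4) * ‖z‖ ^ 2)) := by
      rw [gaussianDensity, ← Real.exp_add]
      refine mul_le_mul_of_nonneg_left (Real.exp_le_exp.2 ?_) hc
      -- `‖z‖² ≤ (‖z - w‖ + ‖w‖)² ≤ 2 ‖z - w‖² + 2 ‖w‖²` with `‖w‖ < 1`
      have h4 : ‖z‖ ≤ ‖z - w‖ + ‖w‖ := by simpa using norm_add_le (z - w) w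
      nlinarith [sq_nonneg (‖z - w‖ - ‖w‖), norm_nonneg z, norm_nonneg w, norm_nonneg (z - w)]
    exact abs_le.2 ⟨by linarith, by linarith⟩
  · exact (((integrable_exp_neg_mul_sq_norm (by norm_num)).const_mul _).const_mul _).add
      integrable_gaussianDensity
  · refine ae_of_all _ fun z => ?_
    have : Continuous fun w : E => |gaussianDensity (z - w) - gaussianDensity z| := by fun_prop
    simpa using this.tendsto 0

lemma norm_integral_stdGaussian_translate_sub_le {F : Type*} [NormedAddCommGroup F]
    [NormedSpace ℝ F] {h : E → F} (hm : StronglyMeasurable h) {C : ℝ} (hC : ∀ z, ‖h z‖ ≤ C)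
    (w : E) :
    ‖∫ z, h (w + z) ∂(stdGaussian E) - ∫ z, h z ∂(stdGaussian E)‖ ≤ C * gaussianShift w := by
  have hint : ∀ w : E, Integrable (fun z => gaussianDensity (z - w) • h z) := fun w =>
    (integrable_gaussianDensity.comp_sub_right w).smul_of_top_left
      (memLp_top_of_bound hm.aestronglyMeasurable C (ae_of_all _ hC))
  have h0 : Integrable (fun z => gaussianDensity z • h z) := by simpa using hint 0
  have h1 : ∫ z, gaussianDensity z • h (w + z) = ∫ z, gaussianDensity (z - w) • h z := by
    rw [← integral_sub_right_eq_self (fun z => gaussianDensity z • h (w + z)) w]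
    simp
  rw [integral_stdGaussian, integral_stdGaussian, h1, ← integral_sub (hint w) h0, gaussianShift,
    ← integral_const_mul]
  refine norm_integral_le_of_norm_le ((integrable_gaussianShift w).const_mul C)
    (ae_of_all _ fun z => ?_)
  rw [← sub_smul, norm_smul, mul_comm, Real.norm_eq_abs]
  exact mul_le_mul_of_nonneg_right (hC z) (abs_nonneg _)

end Gaussian

/-! ### Conditional expectation as a projection in `L²` -/

section SquareIntegrable

variable {F : Type*} [NormedAddCommGroup F]
  {Ω : Type*} {m mΩ : MeasurableSpace Ω} {P : Measure Ω} {f g : Ω → F}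

lemma integrable_norm_sq_of_memLp_two (hf : MemLp f 2 P) : Integrable (fun ω => ‖f ω‖ ^ 2) P :=
  (memLp_two_iff_integrable_sq_norm hf.1).1 hf

variable [InnerProductSpace ℝ F]

lemma integrable_inner_of_memLp_two (hf : MemLp f 2 P) (hg : MemLp g 2 P) :
    Integrable (fun ω => ⟪f ω, g ω⟫) P :=
  memLp_one_iff_integrable.1 ((innerSL ℝ).memLp_of_bilin 1 hf hg)

lemma integral_norm_sub_sq_of_memLp_two (hf : MemLp f 2 P) (hg : MemLp g 2 P) :
    ∫ ω, ‖f ω - g ω‖ ^ 2 ∂P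
      = ∫ ω, ‖f ω‖ ^ 2 ∂P - 2 * ∫ ω, ⟪f ω, g ω⟫ ∂P + ∫ ω, ‖g ω‖ ^ 2 ∂P := by
  have h1 := integrable_norm_sq_of_memLp_two hf
  have h2 := integrable_norm_sq_of_memLp_two hg
  have h3 := (integrable_inner_of_memLp_two hf hg).const_mul 2
  simp_rw [norm_sub_sq_real]
  have h4 : Integrable (fun ω => ‖f ω‖ ^ 2 - 2 * ⟪f ω, g ω⟫) P := h1.sub h3
  rw [integral_add h4 h2, integral_sub h1 h3, integral_const_mul]

lemma norm_add_sq_le_two_mul (x y : F) : ‖x + y‖ ^ 2 ≤ 2 * ‖x‖ ^ 2 + 2 * ‖y‖ ^ 2 := by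
  have h := parallelogram_law_with_norm ℝ x y
  nlinarith [sq_nonneg ‖x - y‖]

lemma integral_norm_add_sq_le (hf : MemLp f 2 P) (hg : MemLp g 2 P) :
    ∫ ω, ‖f ω + g ω‖ ^ 2 ∂P ≤ 2 * ∫ ω, ‖f ω‖ ^ 2 ∂P + 2 * ∫ ω, ‖g ω‖ ^ 2 ∂P := by
  have h1 := (integrable_norm_sq_of_memLp_two hf).const_mul 2
  have h2 := (integrable_norm_sq_of_memLp_two hg).const_mul 2
  rw [← integral_const_mul, ← integral_const_mul, ← integral_add h1 h2]
  exact integral_mono (integrable_norm_sq_of_memLp_two (hf.add hg)) (h1.add h2)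
    fun ω => norm_add_sq_le_two_mul _ _

lemma norm_integral_sq_le [IsProbabilityMeasure P] [CompleteSpace F] (hf : MemLp f 2 P) :
    ‖∫ ω, f ω ∂P‖ ^ 2 ≤ ∫ ω, ‖f ω‖ ^ 2 ∂P := by
  set c := ∫ ω, f ω ∂P with hc
  have h := integral_norm_sub_sq_of_memLp_two hf (memLp_const c)
  have h0 : 0 ≤ ∫ ω, ‖f ω - c‖ ^ 2 ∂P := integral_nonneg fun ω => by positivity
  have h1 : ∫ ω, ⟪f ω, c⟫ ∂P = ‖c‖ ^ 2 := by
    simp_rw [real_inner_comm c]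
    rw [integral_inner (hf.integrable one_le_two), ← hc, real_inner_self_eq_norm_sq]
  rw [h1, integral_const, probReal_univ, one_smul] at h
  linarith

variable [IsProbabilityMeasure P] [CompleteSpace F]

/-- Conditional expectation is the orthogonal projection: only `𝔼[f | m]` matters when `f` is
tested against an `m`-measurable function. -/
lemma integral_inner_condExp (hm : m ≤ mΩ) (hf : MemLp f 2 P) (hg : MemLp g 2 P)
    (hgm : AEStronglyMeasurable[m] g P) :
    ∫ ω, ⟪(P[f | m]) ω, g ω⟫ ∂P = ∫ ω, ⟪f ω, g ω⟫ ∂P := by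
  have h := condExp_bilin_of_aestronglyMeasurable_right (innerSL ℝ) hgm
    (integrable_inner_of_memLp_two hf hg) (hf.integrable one_le_two)
  rw [← integral_condExp hm (f := fun ω => ⟪f ω, g ω⟫)]
  exact (integral_congr_ae h).symm

lemma integral_norm_condExp_sq (hm : m ≤ mΩ) (hf : MemLp f 2 P) :
    ∫ ω, ‖(P[f | m]) ω‖ ^ 2 ∂P = ∫ ω, ⟪f ω, (P[f | m]) ω⟫ ∂P := by
  rw [← integral_inner_condExp hm hf (hf.condExp one_le_two)
    stronglyMeasurable_condExp.aestronglyMeasurable]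
  simp_rw [real_inner_self_eq_norm_sq]

/-- The squared norm of `𝔼[f | m]` is at least the reduction of squared error achieved by any
`m`-measurable approximation `g` of `f`. -/
lemma integral_norm_sq_sub_le_condExp (hm : m ≤ mΩ) (hf : MemLp f 2 P) (hg : MemLp g 2 P)
    (hgm : AEStronglyMeasurable[m] g P) :
    ∫ ω, ‖f ω‖ ^ 2 ∂P - ∫ ω, ‖f ω - g ω‖ ^ 2 ∂P ≤ ∫ ω, ‖(P[f | m]) ω‖ ^ 2 ∂P := by
  have h1 := integral_norm_sub_sq_of_memLp_two hf hg
  have h2 := integral_norm_sub_sq_of_memLp_two (hf.condExp (m := m) one_le_two) hg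
  rw [integral_inner_condExp hm hf hg hgm] at h2
  have h3 : 0 ≤ ∫ ω, ‖(P[f | m]) ω - g ω‖ ^ 2 ∂P := integral_nonneg fun ω => by positivity
  linarith

lemma integral_norm_sub_condExp_sq (hm : m ≤ mΩ) (hf : MemLp f 2 P) :
    ∫ ω, ‖f ω - (P[f | m]) ω‖ ^ 2 ∂P
      = ∫ ω, ‖f ω‖ ^ 2 ∂P - ∫ ω, ‖(P[f | m]) ω‖ ^ 2 ∂P := by
  rw [integral_norm_sub_sq_of_memLp_two hf (hf.condExp one_le_two),
    ← integral_norm_condExp_sq hm hf]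
  ring

lemma integral_norm_condExp_sq_le (hm : m ≤ mΩ) (hf : MemLp f 2 P) :
    ∫ ω, ‖(P[f | m]) ω‖ ^ 2 ∂P ≤ ∫ ω, ‖f ω‖ ^ 2 ∂P := by
  have h := integral_norm_sub_condExp_sq hm hf
  have h0 : 0 ≤ ∫ ω, ‖f ω - (P[f | m]) ω‖ ^ 2 ∂P := integral_nonneg fun ω => by positivity
  linarith

end SquareIntegrable

lemma exists_boundedContinuous_integral_norm_sub_sq_le {E F : Type*} [TopologicalSpace E]
    [NormalSpace E] [MeasurableSpace E] [BorelSpace E] [NormedAddCommGroup F] [NormedSpace ℝ F]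
    {μ : Measure E} [μ.WeaklyRegular] {f : E → F} (hf : MemLp f 2 μ) {ε : ℝ} (hε : 0 < ε) :
    ∃ g : BoundedContinuousFunction E F, ∫ x, ‖f x - g x‖ ^ 2 ∂μ ≤ ε ∧ MemLp g 2 μ := by
  have h2 : ENNReal.ofReal 2 = 2 := by simp
  obtain ⟨g, hg, hg2⟩ := MemLp.exists_boundedContinuous_integral_rpow_sub_le (p := 2) two_pos
    (by rwa [h2]) hε
  exact ⟨g, by simpa using hg, by rwa [h2] at hg2⟩

/-! ### Scores, the Gaussian channel and Tweedie's formula -/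

section Score

variable {E : Type*} [NormedAddCommGroup E] [InnerProductSpace ℝ E] [FiniteDimensional ℝ E]

/-- The score `∇ log p` of a density `p`. -/
def score (p : E → ℝ) (x : E) : E := gradient (fun y => Real.log (p y)) x

lemma mul_inner_score {p : E → ℝ} (hp : ∀ y, 0 < p y) (hpd : Differentiable ℝ p) (x v : E) :
    p x * ⟪score p x, v⟫ = fderiv ℝ p x v := by
  rw [score, gradient, InnerProductSpace.toDual_symm_apply, fderiv.log (hpd x) (hp x).ne']
  simp [(hp x).ne']

variable [MeasurableSpace E] [BorelSpace E]

lemma measurable_score (p : E → ℝ) : Measurable (score p) :=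
  (LinearIsometryEquiv.continuous _).measurable.comp (measurable_fderiv ℝ _)

/-- Integration by parts against a density. Differentiability of `p` with integrable score is
enough: on almost every line `p` is a primitive of its integrable derivative. -/
lemma integral_fderiv_eq_neg_integral_inner_score {p : E → ℝ} (hp : ∀ y, 0 < p y)
    (hpd : Differentiable ℝ p) {μ : Measure E} [IsFiniteMeasure μ]
    (hμ : μ = volume.withDensity (fun y => ENNReal.ofReal (p y)))
    (hs : Integrable (score p) μ) {h : E → ℝ} (hh : ContDiff ℝ 1 h)
    (hc : HasCompactSupport h) (v : E) :
    ∫ x, fderiv ℝ h x v ∂μ = -∫ x, h x * ⟪score p x, v⟫ ∂μ := by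
  have hpm : Measurable (fun y => ENNReal.ofReal (p y)) :=
    hpd.continuous.measurable.ennreal_ofReal
  have hdcont : Continuous (fun x => fderiv ℝ h x v) := by
    have := hh.continuous_fderiv one_ne_zero
    fun_prop
  have hdc : HasCompactSupport (fun x => fderiv ℝ h x v) := hc.fderiv_apply ℝ v
  have hcont := hh.continuous
  have hpc := hpd.continuous
  obtain ⟨C, hC⟩ := hc.exists_bound_of_continuous hcont
  have hint : Integrable (fun x => h x * ⟪score p x, v⟫) μ :=
    (hs.inner_const v).smul_of_top_right
      (memLp_top_of_bound hcont.aestronglyMeasurable C (ae_of_all _ hC))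
  have hrw : ∀ x, (ENNReal.ofReal (p x)).toReal • (h x * ⟪score p x, v⟫)
      = fderiv ℝ p x v * h x := fun x => by
    rw [ENNReal.toReal_ofReal (hp x).le, ← mul_inner_score hp hpd, smul_eq_mul]
    ring
  rw [hμ, integrable_withDensity_iff_integrable_smul' hpm (by simp)] at hint
  simp_rw [hrw] at hint
  rw [hμ, integral_withDensity_eq_integral_toReal_smul hpm (by simp),
    integral_withDensity_eq_integral_toReal_smul hpm (by simp)]
  simp_rw [hrw, ENNReal.toReal_ofReal (hp _).le, smul_eq_mul]
  exact integral_mul_fderiv_eq_neg_fderiv_mul_of_integrable hint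
    (Continuous.integrable_of_hasCompactSupport (by fun_prop) hdc.mul_left)
    (Continuous.integrable_of_hasCompactSupport (by fun_prop) hc.mul_left)
    (fun x _ => hpd x) (fun x _ => (hh.differentiable one_ne_zero) x)

end Score

section Channel

variable {E : Type*} [NormedAddCommGroup E] [InnerProductSpace ℝ E] [FiniteDimensional ℝ E]
  [MeasurableSpace E]
  {Ω : Type*} {mΩ : MeasurableSpace Ω}

/-- The observation `u + σ τ`. -/
def observe (u τ : Ω → E) (σ : ℝ) (ω : Ω) : E := u ω + σ • τ ω

/-- The `σ`-algebra generated by the observation. -/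
abbrev observedSigma (u τ : Ω → E) (σ : ℝ) : MeasurableSpace Ω :=
  MeasurableSpace.comap (observe u τ σ) inferInstance

/-- The random vectors `u` (the signal, of law `μ`) and `τ` (the noise, standard Gaussian) are
independent. -/
structure GaussianChannel (P : Measure Ω) (u τ : Ω → E) (μ : Measure E) : Prop where
  measurable_signal : Measurable u
  measurable_noise : Measurable τ
  map_eq : P.map (fun ω => (u ω, τ ω)) = μ.prod (stdGaussian E)

namespace GaussianChannel

variable {P : Measure Ω} {u τ : Ω → E} {μ : Measure E}

lemma measurable_pair (H : GaussianChannel P u τ μ) : Measurable (fun ω => (u ω, τ ω)) :=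
  H.measurable_signal.prodMk H.measurable_noise

lemma integral_pair {F : Type*} [NormedAddCommGroup F] [NormedSpace ℝ F]
    (H : GaussianChannel P u τ μ) {f : E × E → F} (hf : StronglyMeasurable f) :
    ∫ ω, f (u ω, τ ω) ∂P = ∫ z, f z ∂(μ.prod (stdGaussian E)) := by
  rw [← H.map_eq, integral_map H.measurable_pair.aemeasurable hf.aestronglyMeasurable]

lemma integrable_pair {F : Type*} [NormedAddCommGroup F]
    (H : GaussianChannel P u τ μ) {f : E × E → F} (hf : StronglyMeasurable f) :
    Integrable (fun ω => f (u ω, τ ω)) P ↔ Integrable f (μ.prod (stdGaussian E)) := by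
  rw [← H.map_eq, integrable_map_measure hf.aestronglyMeasurable H.measurable_pair.aemeasurable]
  rfl

variable [BorelSpace E]

lemma measurable_observe (H : GaussianChannel P u τ μ) (σ : ℝ) : Measurable (observe u τ σ) :=
  H.measurable_signal.add (H.measurable_noise.const_smul σ)

lemma comap_le (H : GaussianChannel P u τ μ) (σ : ℝ) :
    observedSigma u τ σ ≤ mΩ :=
  (H.measurable_observe σ).comap_le

lemma map_signal (H : GaussianChannel P u τ μ) : P.map u = μ := by
  have h := congrArg (Measure.map Prod.fst) H.map_eq
  rw [Measure.map_map measurable_fst H.measurable_pair] at h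
  simpa [Function.comp_def] using h

lemma map_noise [IsProbabilityMeasure μ] (H : GaussianChannel P u τ μ) :
    P.map τ = stdGaussian E := by
  have h := congrArg (Measure.map Prod.snd) H.map_eq
  rw [Measure.map_map measurable_snd H.measurable_pair] at h
  simpa [Function.comp_def] using h

lemma memLp_noise [IsProbabilityMeasure μ] (H : GaussianChannel P u τ μ) : MemLp τ 2 P := by
  have h : MemLp (fun x : E => x) 2 (P.map τ) := by
    rw [H.map_noise]; exact memLp_two_id_stdGaussian
  exact (memLp_map_measure_iff (by fun_prop) H.measurable_noise.aemeasurable).1 h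

lemma memLp_signal (H : GaussianChannel P u τ μ) {f : E → E} (hf : MemLp f 2 μ) :
    MemLp (fun ω => f (u ω)) 2 P := by
  rw [← H.map_signal] at hf
  exact (memLp_map_measure_iff hf.aestronglyMeasurable H.measurable_signal.aemeasurable).1 hf

lemma integral_noise_norm_sq [IsProbabilityMeasure μ] (H : GaussianChannel P u τ μ) :
    ∫ ω, ‖τ ω‖ ^ 2 ∂P = Module.finrank ℝ E := by
  rw [← integral_norm_sq_stdGaussian (E := E), ← H.map_noise,
    integral_map H.measurable_noise.aemeasurable (by fun_prop)]

lemma integral_signal {F : Type*} [NormedAddCommGroup F] [NormedSpace ℝ F]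
    (H : GaussianChannel P u τ μ) {f : E → F} (hf : AEStronglyMeasurable f μ) :
    ∫ ω, f (u ω) ∂P = ∫ x, f x ∂μ := by
  rw [← H.map_signal] at hf ⊢
  rw [integral_map H.measurable_signal.aemeasurable hf]

/-- The noise is centred, so it is uncorrelated with every function of the signal. -/
lemma integral_inner_signal_noise [IsProbabilityMeasure μ] (H : GaussianChannel P u τ μ)
    {f : E → E} (hf : MemLp f 2 μ) (hfm : Measurable f) : ∫ ω, ⟪f (u ω), τ ω⟫ ∂P = 0 := by
  have hi : Integrable (fun ω => ⟪f (u ω), τ ω⟫) P :=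
    integrable_inner_of_memLp_two (H.memLp_signal hf) H.memLp_noise
  have hm : StronglyMeasurable (fun z : E × E => ⟪f z.1, z.2⟫) := by
    apply Measurable.stronglyMeasurable; fun_prop
  rw [H.integral_pair hm, integral_prod _ ((H.integrable_pair hm).1 hi)]
  refine integral_eq_zero_of_ae (ae_of_all _ fun x => ?_)
  have := integral_strongDual_stdGaussian (innerSL ℝ (f x))
  simpa using this

/-- Tested against a function of the observation, the noise and `-σ` times the score of the
signal agree: both integrations by parts produce the derivative of the test function. -/
lemma integral_smul_noise_add_score [IsProbabilityMeasure P] [IsProbabilityMeasure μ]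
    (H : GaussianChannel P u τ μ)
    {p : E → ℝ} (hp : ∀ y, 0 < p y) (hpd : Differentiable ℝ p)
    (hμ : μ = volume.withDensity (fun y => ENNReal.ofReal (p y)))
    (hs : MemLp (score p) 2 μ) {σ : ℝ} (hσ : σ ≠ 0) {h : E → ℝ} (hh : ContDiff ℝ 1 h)
    (hc : HasCompactSupport h) :
    ∫ ω, h (observe u τ σ ω) • (τ ω + σ • score p (u ω)) ∂P = 0 := by
  have hcont := hh.continuous
  obtain ⟨C, hC⟩ := hc.exists_bound_of_continuous hcont
  have hbdd : MemLp (fun ω => h (observe u τ σ ω)) ⊤ P :=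
    memLp_top_of_bound (hcont.measurable.comp (H.measurable_observe σ)).aestronglyMeasurable C
      (ae_of_all _ fun ω => hC _)
  have hτ := H.memLp_noise.integrable one_le_two
  have hsu := (H.memLp_signal hs).integrable one_le_two
  have hI : Integrable (fun ω => h (observe u τ σ ω) • (τ ω + σ • score p (u ω))) P :=
    (hτ.add (hsu.smul σ)).smul_of_top_right hbdd
  refine ext_inner_left ℝ fun v => ?_
  rw [← integral_inner hI, inner_zero_right]
  have hI1 : Integrable (fun ω => h (observe u τ σ ω) * ⟪τ ω, v⟫) P :=
    (hτ.inner_const v).smul_of_top_right hbdd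
  have hI2 : Integrable (fun ω => h (observe u τ σ ω) * ⟪score p (u ω), v⟫) P :=
    (hsu.inner_const v).smul_of_top_right hbdd
  have hdcont : Continuous (fun x => fderiv ℝ h x v) := by
    have := hh.continuous_fderiv one_ne_zero
    fun_prop
  obtain ⟨D, hD⟩ := (hc.fderiv_apply ℝ v).exists_bound_of_continuous hdcont
  have hm1 : StronglyMeasurable (fun z : E × E => h (z.1 + σ • z.2) * ⟪z.2, v⟫) := by
    apply Continuous.stronglyMeasurable; fun_prop
  have hm2 : StronglyMeasurable (fun z : E × E => h (z.1 + σ • z.2) * ⟪score p z.1, v⟫) := by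
    have := measurable_score p
    have := hcont.measurable
    apply Measurable.stronglyMeasurable; fun_prop
  have hd : Integrable (fun z : E × E => fderiv ℝ h (z.1 + σ • z.2) v)
      (μ.prod (stdGaussian E)) :=
    Integrable.of_bound (by fun_prop) D (ae_of_all _ fun z => hD _)
  have h1 : ∫ ω, h (observe u τ σ ω) * ⟪τ ω, v⟫ ∂P
      = σ * ∫ z : E × E, fderiv ℝ h (z.1 + σ • z.2) v ∂(μ.prod (stdGaussian E)) := by
    refine (H.integral_pair hm1).trans ?_
    rw [integral_prod _ ((H.integrable_pair hm1).1 hI1), integral_prod _ hd, ← integral_const_mul]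
    refine integral_congr_ae (ae_of_all _ fun x => ?_)
    have hg : ContDiff ℝ 1 (fun z : E => h (x + σ • z)) := by fun_prop
    have hgc : HasCompactSupport (fun z : E => h (x + σ • z)) :=
      hc.comp_homeomorph ((Homeomorph.smulOfNeZero σ hσ).trans (Homeomorph.addLeft x))
    have hgd : ∀ z, fderiv ℝ (fun z : E => h (x + σ • z)) z v
        = σ * fderiv ℝ h (x + σ • z) v := fun z => by
      have h3 : HasFDerivAt (fun z : E => x + σ • z) (σ • ContinuousLinearMap.id ℝ E) z :=
        ((hasFDerivAt_id z).const_smul σ).const_add x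
      have h4 := ((hh.differentiable one_ne_zero) (x + σ • z)).hasFDerivAt.comp z h3
      have h5 := h4.fderiv
      simp only [Function.comp_def] at h5
      rw [h5]; simp
    have h6 := integral_inner_mul_stdGaussian hg hgc v
    simp_rw [hgd, integral_const_mul] at h6
    simp only
    rw [← h6]
    simp_rw [mul_comm]
  have h2 : ∫ ω, h (observe u τ σ ω) * ⟪score p (u ω), v⟫ ∂P
      = -∫ z : E × E, fderiv ℝ h (z.1 + σ • z.2) v ∂(μ.prod (stdGaussian E)) := by
    refine (H.integral_pair hm2).trans ?_
    rw [integral_prod_symm _ ((H.integrable_pair hm2).1 hI2), integral_prod_symm _ hd,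
      ← integral_neg]
    refine integral_congr_ae (ae_of_all _ fun z => ?_)
    have hg : ContDiff ℝ 1 (fun x : E => h (x + σ • z)) := by fun_prop
    have hgc : HasCompactSupport (fun x : E => h (x + σ • z)) :=
      hc.comp_homeomorph (Homeomorph.addRight (σ • z))
    have h6 := integral_fderiv_eq_neg_integral_inner_score hp hpd hμ (hs.integrable one_le_two)
      hg hgc v
    simp_rw [fderiv_comp_add_right] at h6
    simp only
    rw [h6, neg_neg]
  have h3 : ∀ ω, ⟪v, h (observe u τ σ ω) • (τ ω + σ • score p (u ω))⟫
      = h (observe u τ σ ω) * ⟪τ ω, v⟫ + σ * (h (observe u τ σ ω) * ⟪score p (u ω), v⟫) := by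
    intro ω
    rw [inner_smul_right, inner_add_right, inner_smul_right, real_inner_comm (τ ω) v,
      real_inner_comm (score p (u ω)) v]
    ring
  simp_rw [h3]
  rw [integral_add hI1 (hI2.const_mul σ), integral_const_mul, h1, h2]
  ring

/-- The posterior mean of the noise is `-σ` times the posterior mean of the score of the signal
(Tweedie's formula). -/
lemma condExp_noise_add_score [IsProbabilityMeasure P] [IsProbabilityMeasure μ]
    (H : GaussianChannel P u τ μ)
    {p : E → ℝ} (hp : ∀ y, 0 < p y) (hpd : Differentiable ℝ p)
    (hμ : μ = volume.withDensity (fun y => ENNReal.ofReal (p y)))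
    (hs : MemLp (score p) 2 μ) {σ : ℝ} (hσ : σ ≠ 0) :
    P[fun ω => τ ω + σ • score p (u ω) | observedSigma u τ σ] =ᵐ[P] 0 := by
  have hm : observedSigma u τ σ ≤ mΩ := H.comap_le σ
  set Z : Ω → E := fun ω => τ ω + σ • score p (u ω) with hZ
  have hZi : Integrable Z P :=
    (H.memLp_noise.integrable one_le_two).add (((H.memLp_signal hs).integrable one_le_two).smul σ)
  obtain ⟨g, hg, hgeq⟩ := (stronglyMeasurable_condExp (m := observedSigma u τ σ) (f := Z)
    (μ := P)).exists_eq_measurable_comp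
  have hY := H.measurable_observe σ
  have hgi : Integrable g (P.map (observe u τ σ)) := by
    rw [integrable_map_measure hg.aestronglyMeasurable hY.aemeasurable, ← hgeq]
    exact integrable_condExp
  have := Measure.isProbabilityMeasure_map (μ := P) hY.aemeasurable
  have hzero : ∀ᵐ y ∂(P.map (observe u τ σ)), g y = 0 := by
    refine ae_eq_zero_of_integral_contDiff_smul_eq_zero hgi.locallyIntegrable fun h hh hc => ?_
    have hh1 : ContDiff ℝ 1 h := hh.of_le (by exact_mod_cast le_top)
    have hcont := hh.continuous
    obtain ⟨C, hC⟩ := hc.exists_bound_of_continuous hcont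
    have hms : StronglyMeasurable[observedSigma u τ σ] (fun ω => h (observe u τ σ ω)) :=
      (hcont.measurable.comp (comap_measurable _)).stronglyMeasurable
    have hbdd : MemLp (fun ω => h (observe u τ σ ω)) ⊤ P :=
      memLp_top_of_bound (hms.mono hm).aestronglyMeasurable C (ae_of_all _ fun ω => hC _)
    have hgae : AEStronglyMeasurable (fun x => h x • g x) (P.map (observe u τ σ)) :=
      hcont.aestronglyMeasurable.smul hg.aestronglyMeasurable
    rw [integral_map hY.aemeasurable hgae]
    refine Eq.trans ?_ ((integral_condExp hm).trans
      (H.integral_smul_noise_add_score hp hpd hμ hs hσ hh1 hc))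
    refine integral_congr_ae ?_
    filter_upwards [condExp_smul_of_aestronglyMeasurable_left (μ := P) (m := observedSigma u τ σ)
      hms.aestronglyMeasurable (hZi.smul_of_top_right hbdd) hZi] with ω hω
    have h7 : P[Z | observedSigma u τ σ] ω = g (observe u τ σ ω) := congrFun hgeq ω
    rw [← h7]
    exact hω.symm
  filter_upwards [ae_of_ae_map hY.aemeasurable hzero] with ω hω
  rw [hgeq]
  exact hω

end GaussianChannel

end Channel

/-! ### Prediction of the noise and of the signal from the observation -/

section ChannelEstimates

variable {E : Type*} [NormedAddCommGroup E] [InnerProductSpace ℝ E] [FiniteDimensional ℝ E]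
  [MeasurableSpace E] [BorelSpace E]
  {Ω : Type*} {mΩ : MeasurableSpace Ω}

namespace GaussianChannel

variable {P : Measure Ω} {u τ : Ω → E} {μ : Measure E} [IsProbabilityMeasure μ]

lemma memLp_observe (H : GaussianChannel P u τ μ) (hu : MemLp (fun x => x) 2 μ) (σ : ℝ) :
    MemLp (observe u τ σ) 2 P :=
  (H.memLp_signal hu).add (H.memLp_noise.const_smul σ)

/-- Second moment of a combination of the noise and a function of the signal. -/
lemma integral_norm_smul_sub_sq (H : GaussianChannel P u τ μ) {f : E → E} (hf : MemLp f 2 μ)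
    (hfm : Measurable f) (a b : ℝ) :
    ∫ ω, ‖a • τ ω - b • f (u ω)‖ ^ 2 ∂P
      = a ^ 2 * Module.finrank ℝ E + b ^ 2 * ∫ x, ‖f x‖ ^ 2 ∂μ := by
  have h1 := H.memLp_noise
  have h2 := H.memLp_signal hf
  have h3 := integral_norm_sub_sq_of_memLp_two (h1.const_smul a) (h2.const_smul b)
  simp only [Pi.smul_apply, inner_smul_left, inner_smul_right, norm_smul, mul_pow,
    integral_const_mul] at h3
  rw [h3, H.integral_noise_norm_sq,
    H.integral_signal (f := fun x => ‖f x‖ ^ 2) (integrable_norm_sq_of_memLp_two hf).1]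
  simp_rw [fun ω => real_inner_comm (f (u ω)) (τ ω)]
  rw [H.integral_inner_signal_noise hf hfm]
  simp

variable [IsProbabilityMeasure P]

/-- The noise is at least as predictable from the observation as by the best multiple of the
observation itself. -/
lemma le_integral_norm_condExp_noise_sq (H : GaussianChannel P u τ μ)
    (hu : MemLp (fun x => x) 2 μ) (σ c : ℝ) :
    Module.finrank ℝ E - ((1 - c * σ) ^ 2 * Module.finrank ℝ E + c ^ 2 * ∫ x, ‖x‖ ^ 2 ∂μ)
      ≤ ∫ ω, ‖(P[τ | observedSigma u τ σ]) ω‖ ^ 2 ∂P := by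
  have h := integral_norm_sq_sub_le_condExp (H.comap_le σ) H.memLp_noise
    ((H.memLp_observe hu σ).const_smul c)
    ((comap_measurable (observe u τ σ)).stronglyMeasurable.const_smul c).aestronglyMeasurable
  rw [← H.integral_norm_smul_sub_sq hu measurable_id]
  rw [H.integral_noise_norm_sq] at h
  refine le_trans (le_of_eq ?_) h
  congr 2
  ext ω
  congr 2
  simp only [Pi.smul_apply, observe]
  module

lemma condExp_noise_eq_neg_smul_condExp_score (H : GaussianChannel P u τ μ)
    {p : E → ℝ} (hp : ∀ y, 0 < p y) (hpd : Differentiable ℝ p)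
    (hμ : μ = volume.withDensity (fun y => ENNReal.ofReal (p y)))
    (hs : MemLp (score p) 2 μ) {σ : ℝ} (hσ : σ ≠ 0) :
    P[τ | observedSigma u τ σ]
      =ᵐ[P] fun ω => -(σ • (P[fun ω => score p (u ω) | observedSigma u τ σ]) ω) := by
  have hτ := H.memLp_noise.integrable one_le_two
  have hsu := (H.memLp_signal hs).integrable one_le_two
  filter_upwards [H.condExp_noise_add_score hp hpd hμ hs hσ,
    condExp_add hτ (hsu.smul σ) (observedSigma u τ σ),
    condExp_smul (μ := P) σ (fun ω => score p (u ω)) (observedSigma u τ σ)] with ω h1 h2 h3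
  have h4 := h2.symm.trans h1
  rw [Pi.add_apply, h3] at h4
  exact eq_neg_of_add_eq_zero_left h4

/-- By Tweedie's formula `τ` and `(1 - a) τ - a σ s(u)` have the same posterior mean, for every
`a`, and conditional expectation is a contraction. -/
lemma integral_norm_condExp_noise_sq_le (H : GaussianChannel P u τ μ)
    {p : E → ℝ} (hp : ∀ y, 0 < p y) (hpd : Differentiable ℝ p)
    (hμ : μ = volume.withDensity (fun y => ENNReal.ofReal (p y)))
    (hs : MemLp (score p) 2 μ) {σ : ℝ} (hσ : σ ≠ 0) (a : ℝ) :
    ∫ ω, ‖(P[τ | observedSigma u τ σ]) ω‖ ^ 2 ∂P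
      ≤ (1 - a) ^ 2 * Module.finrank ℝ E + (a * σ) ^ 2 * ∫ x, ‖score p x‖ ^ 2 ∂μ := by
  have hτ := H.memLp_noise
  have hsu := H.memLp_signal hs
  rw [← H.integral_norm_smul_sub_sq hs (measurable_score p)]
  have h := integral_norm_condExp_sq_le (H.comap_le σ)
    ((hτ.const_smul (1 - a)).sub (hsu.const_smul (a * σ)))
  refine le_trans (le_of_eq (integral_congr_ae ?_)) h
  filter_upwards [H.condExp_noise_eq_neg_smul_condExp_score hp hpd hμ hs hσ,
    condExp_sub ((hτ.const_smul (1 - a)).integrable one_le_two)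
      ((hsu.const_smul (a * σ)).integrable one_le_two) (observedSigma u τ σ),
    condExp_smul (μ := P) (1 - a) τ (observedSigma u τ σ),
    condExp_smul (μ := P) (a * σ) (fun ω => score p (u ω)) (observedSigma u τ σ)]
    with ω h1 h2 h3 h4
  rw [h2, Pi.sub_apply, h3, h4, Pi.smul_apply, Pi.smul_apply, h1]
  congr 2
  module

lemma integral_norm_condExp_noise_sq_eq_score (H : GaussianChannel P u τ μ)
    {p : E → ℝ} (hp : ∀ y, 0 < p y) (hpd : Differentiable ℝ p)
    (hμ : μ = volume.withDensity (fun y => ENNReal.ofReal (p y)))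
    (hs : MemLp (score p) 2 μ) {σ : ℝ} (hσ : σ ≠ 0) :
    ∫ ω, ‖(P[τ | observedSigma u τ σ]) ω‖ ^ 2 ∂P
      = σ ^ 2 * ∫ ω, ‖(P[fun ω => score p (u ω) | observedSigma u τ σ]) ω‖ ^ 2 ∂P := by
  rw [← integral_const_mul]
  refine integral_congr_ae ?_
  filter_upwards [H.condExp_noise_eq_neg_smul_condExp_score hp hpd hμ hs hσ] with ω h
  rw [h, norm_neg, norm_smul, mul_pow, Real.norm_eq_abs, sq_abs]

/-- The posterior means of the signal and of `σ τ` add up to the observation. -/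
lemma condExp_signal_sub_observe (H : GaussianChannel P u τ μ)
    (hu : MemLp (fun x => x) 2 μ) (σ : ℝ) :
    (fun ω => (P[u | observedSigma u τ σ]) ω - observe u τ σ ω)
      =ᵐ[P] fun ω => -(σ • (P[τ | observedSigma u τ σ]) ω) := by
  have hui := (H.memLp_signal hu).integrable one_le_two
  have hτi := H.memLp_noise.integrable one_le_two
  have hYi := (H.memLp_observe hu σ).integrable one_le_two
  have hY : P[observe u τ σ | observedSigma u τ σ] = observe u τ σ :=
    condExp_of_stronglyMeasurable (H.comap_le σ)
      (comap_measurable (observe u τ σ)).stronglyMeasurable hYi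
  filter_upwards [condExp_add hui (hτi.smul σ) (observedSigma u τ σ),
    condExp_smul (μ := P) σ τ (observedSigma u τ σ)] with ω h1 h2
  have h3 : (P[u + σ • τ | observedSigma u τ σ]) ω = observe u τ σ ω := congrFun hY ω
  rw [h1, Pi.add_apply, h2, Pi.smul_apply] at h3
  rw [← h3]
  abel

/-- Splitting the noise into posterior mean and residual, the residual of `σ τ` being minus that
of the signal. -/
lemma sq_mul_integral_norm_condExp_noise_sq (H : GaussianChannel P u τ μ)
    (hu : MemLp (fun x => x) 2 μ) (σ : ℝ) :
    σ ^ 2 * ∫ ω, ‖(P[τ | observedSigma u τ σ]) ω‖ ^ 2 ∂P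
      = σ ^ 2 * Module.finrank ℝ E - ∫ x, ‖x‖ ^ 2 ∂μ
        + ∫ ω, ‖(P[u | observedSigma u τ σ]) ω‖ ^ 2 ∂P := by
  have h1 := integral_norm_sub_condExp_sq (H.comap_le σ) (H.memLp_signal hu)
  have h2 := integral_norm_sub_condExp_sq (H.comap_le σ) H.memLp_noise
  rw [H.integral_noise_norm_sq] at h2
  rw [H.integral_signal (f := fun x => ‖x‖ ^ 2) (by fun_prop)] at h1
  have h3 : ∫ ω, ‖u ω - (P[u | observedSigma u τ σ]) ω‖ ^ 2 ∂P
      = σ ^ 2 * ∫ ω, ‖τ ω - (P[τ | observedSigma u τ σ]) ω‖ ^ 2 ∂P := by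
    rw [← integral_const_mul]
    refine integral_congr_ae ?_
    filter_upwards [H.condExp_signal_sub_observe hu σ] with ω h
    have h4 : u ω - (P[u | observedSigma u τ σ]) ω
        = -(σ • (τ ω - (P[τ | observedSigma u τ σ]) ω)) := by
      rw [sub_eq_iff_eq_add.1 h, observe]
      module
    rw [h4, norm_neg, norm_smul, mul_pow, Real.norm_eq_abs, sq_abs]
  rw [h3, h2] at h1
  linarith

/-- As the noise level tends to zero, the observation determines every square integrable function
of the signal. -/
lemma tendsto_integral_norm_condExp_sq_zero (H : GaussianChannel P u τ μ) {f : E → E}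
    (hf : MemLp f 2 μ) :
    Tendsto (fun σ : ℝ => ∫ ω, ‖(P[fun ω => f (u ω) | observedSigma u τ σ]) ω‖ ^ 2 ∂P) (𝓝 0)
      (𝓝 (∫ x, ‖f x‖ ^ 2 ∂μ)) := by
  have hfu := H.memLp_signal hf
  have hfi : ∫ ω, ‖f (u ω)‖ ^ 2 ∂P = ∫ x, ‖f x‖ ^ 2 ∂μ :=
    H.integral_signal (f := fun x => ‖f x‖ ^ 2) (integrable_norm_sq_of_memLp_two hf).1
  refine tendsto_order.2 ⟨fun b hb => ?_, fun b hb => Eventually.of_forall fun σ => ?_⟩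
  · set ε := (∫ x, ‖f x‖ ^ 2 ∂μ - b) / 4 with hε
    have hεpos : 0 < ε := by rw [hε]; linarith
    obtain ⟨g, hg, hg2⟩ := exists_boundedContinuous_integral_norm_sub_sq_le hf hεpos
    have hgc : Continuous g := g.continuous
    have hum := H.measurable_signal
    have hτm := H.measurable_noise
    have hgY : ∀ σ, MemLp (fun ω => g (observe u τ σ ω)) 2 P := fun σ =>
      MemLp.of_bound (hgc.measurable.comp (H.measurable_observe σ)).aestronglyMeasurable ‖g‖
        (ae_of_all _ fun ω => g.norm_coe_le_norm _)
    have hlim : Tendsto (fun σ : ℝ => ∫ ω, ‖g (u ω) - g (observe u τ σ ω)‖ ^ 2 ∂P) (𝓝 0)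
        (𝓝 0) := by
      have h := tendsto_integral_filter_of_dominated_convergence (μ := P) (l := 𝓝 (0 : ℝ))
        (F := fun σ ω => ‖g (u ω) - g (observe u τ σ ω)‖ ^ 2) (f := fun _ => (0 : ℝ))
        (fun _ => (‖g‖ + ‖g‖) ^ 2)
        (Eventually.of_forall fun σ =>
          (integrable_norm_sq_of_memLp_two ((H.memLp_signal hg2).sub (hgY σ))).1)
        (Eventually.of_forall fun σ => ae_of_all _ fun ω => ?_) (integrable_const _)
        (ae_of_all _ fun ω => ?_)
      · simpa only [integral_zero] using h
      · rw [Real.norm_of_nonneg (by positivity)]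
        gcongr
        exact (norm_sub_le _ _).trans (add_le_add (g.norm_coe_le_norm _) (g.norm_coe_le_norm _))
      · have hc : Continuous fun σ : ℝ => ‖g (u ω) - g (observe u τ σ ω)‖ ^ 2 := by
          unfold observe; fun_prop
        simpa [observe] using hc.tendsto 0
    filter_upwards [hlim.eventually_lt_const hεpos] with σ hσ
    have h1 := integral_norm_sq_sub_le_condExp (H.comap_le σ) hfu (hgY σ)
      (hgc.measurable.comp
        (comap_measurable (observe u τ σ))).stronglyMeasurable.aestronglyMeasurable
    have h2 := integral_norm_add_sq_le (hfu.sub (H.memLp_signal hg2))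
      ((H.memLp_signal hg2).sub (hgY σ))
    simp only [Pi.sub_apply, sub_add_sub_cancel] at h2
    have h3 : ∫ ω, ‖f (u ω) - g (u ω)‖ ^ 2 ∂P = ∫ x, ‖f x - g x‖ ^ 2 ∂μ :=
      H.integral_signal (f := fun x => ‖f x - g x‖ ^ 2)
        (integrable_norm_sq_of_memLp_two (hf.sub hg2)).1
    rw [hfi] at h1
    linarith
  · exact (integral_norm_condExp_sq_le (H.comap_le σ) hfu).trans_lt (by rwa [hfi])

/-- A bounded centred function of the signal is predicted from `u + σ τ` no better than the
Gaussian density is changed by the shift `u / σ`: were the observation replaced by `σ τ`, the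
correlation with the posterior mean would vanish. -/
lemma integral_norm_condExp_sq_le_gaussianShift (H : GaussianChannel P u τ μ) {g : E → E}
    (hgm : Measurable g) {C : ℝ} (hC : ∀ x, ‖g x‖ ≤ C) (hg0 : ∫ x, g x ∂μ = 0) {σ : ℝ}
    (hσ : σ ≠ 0) :
    ∫ ω, ‖(P[fun ω => g (u ω) | observedSigma u τ σ]) ω‖ ^ 2 ∂P
      ≤ C * (C * ∫ x, gaussianShift (σ⁻¹ • x) ∂μ) := by
  have hC0 : 0 ≤ C := (norm_nonneg _).trans (hC 0)
  have hg2 : MemLp g 2 μ := MemLp.of_bound hgm.aestronglyMeasurable C (ae_of_all _ hC)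
  have hgu := H.memLp_signal hg2
  obtain ⟨k, hk, hkeq⟩ := (stronglyMeasurable_condExp (m := observedSigma u τ σ)
    (f := fun ω => g (u ω)) (μ := P)).exists_eq_measurable_comp
  -- truncating `k` where it exceeds the almost sure bound `C` makes it bounded everywhere
  set k' : E → E := {x | ‖k x‖ ≤ C}.indicator k with hk'
  have hk'm : StronglyMeasurable k' :=
    hk.indicator (measurableSet_le hk.norm.measurable measurable_const)
  have hk'C : ∀ x, ‖k' x‖ ≤ C := fun x => by
    by_cases hx : x ∈ {x | ‖k x‖ ≤ C}
    · rw [hk', Set.indicator_of_mem hx]; exact hx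
    · rw [hk', Set.indicator_of_notMem hx, norm_zero]; exact hC0
  have hae : P[fun ω => g (u ω) | observedSigma u τ σ] =ᵐ[P] fun ω => k' (observe u τ σ ω) := by
    filter_upwards [ae_bdd_norm_condExp_of_ae_bdd_norm (μ := P) (m := observedSigma u τ σ)
      (ae_of_all _ fun ω => hC (u ω))] with ω hω
    rw [hkeq, Function.comp_apply] at hω ⊢
    rw [hk', Set.indicator_of_mem (show observe u τ σ ω ∈ {x | ‖k x‖ ≤ C} from hω)]
  have hmeas : StronglyMeasurable (fun z : E × E => ⟪g z.1, k' (z.1 + σ • z.2)⟫) := by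
    have := hk'm.measurable
    apply Measurable.stronglyMeasurable; fun_prop
  have hint : Integrable (fun z : E × E => ⟪g z.1, k' (z.1 + σ • z.2)⟫)
      (μ.prod (stdGaussian E)) :=
    Integrable.of_bound hmeas.aestronglyMeasurable (C * C) (ae_of_all _ fun z =>
      (norm_inner_le_norm _ _).trans (mul_le_mul (hC _) (hk'C _) (norm_nonneg _) hC0))
  set K : E → E := fun x => ∫ z, k' (x + σ • z) ∂(stdGaussian E) with hK
  have hinn : ∀ x, ∫ z, ⟪g x, k' (x + σ • z)⟫ ∂(stdGaussian E) = ⟪g x, K x⟫ := fun x => by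
    have hki : Integrable (fun z => k' (x + σ • z)) (stdGaussian E) :=
      Integrable.of_bound (hk'm.measurable.comp (by fun_prop)).aestronglyMeasurable C
        (ae_of_all _ fun z => hk'C _)
    rw [hK, ← integral_inner hki]
  have hKg : Integrable (fun x => ⟪g x, K x⟫) μ := by
    have := hint.integral_prod_left
    simpa only [hinn] using this
  have hgi := hg2.integrable one_le_two
  have hK0 : ∫ x, ⟪g x, K 0⟫ ∂μ = 0 := by
    simp_rw [real_inner_comm (K 0)]
    rw [integral_inner hgi, hg0, inner_zero_right]
  have hshift : StronglyMeasurable (fun x : E => gaussianShift (σ⁻¹ • x)) :=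
    stronglyMeasurable_gaussianShift.comp_measurable (measurable_const_smul _)
  have hshifti : Integrable (fun x : E => gaussianShift (σ⁻¹ • x)) μ :=
    Integrable.of_bound hshift.aestronglyMeasurable 2 (ae_of_all _ fun x => by
      rw [Real.norm_of_nonneg (gaussianShift_nonneg _)]; exact gaussianShift_le_two _)
  calc ∫ ω, ‖(P[fun ω => g (u ω) | observedSigma u τ σ]) ω‖ ^ 2 ∂P
      = ∫ ω, ⟪g (u ω), k' (observe u τ σ ω)⟫ ∂P := by
        rw [integral_norm_condExp_sq (H.comap_le σ) hgu]
        refine integral_congr_ae ?_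
        filter_upwards [hae] with ω hω
        rw [hω]
    _ = ∫ x, ⟪g x, K x⟫ ∂μ := by
        refine (H.integral_pair hmeas).trans ?_
        rw [integral_prod _ hint]
        simp_rw [hinn]
    _ = ∫ x, ⟪g x, K x - K 0⟫ ∂μ := by
        simp_rw [inner_sub_right]
        rw [integral_sub hKg (hgi.inner_const _), hK0, sub_zero]
    _ ≤ ∫ x, C * (C * gaussianShift (σ⁻¹ • x)) ∂μ := by
        refine integral_mono ?_ ((hshifti.const_mul C).const_mul C) fun x => ?_
        · simp_rw [inner_sub_right]
          exact hKg.sub (hgi.inner_const _)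
        · refine (real_inner_le_norm _ _).trans
            (mul_le_mul (hC x) ?_ (norm_nonneg _) hC0)
          have h := norm_integral_stdGaussian_translate_sub_le
            (h := fun z => k' (σ • z)) (hk'm.comp_measurable (measurable_const_smul σ))
            (fun z => hk'C _) (σ⁻¹ • x)
          simpa [hK, smul_smul, hσ] using h
    _ = C * (C * ∫ x, gaussianShift (σ⁻¹ • x) ∂μ) := by
        rw [integral_const_mul, integral_const_mul]

/-- As the noise level tends to infinity, the posterior mean of a centred square integrable
function of the signal tends to zero. -/
lemma tendsto_integral_norm_condExp_sq_atTop (H : GaussianChannel P u τ μ) {f : E → E}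
    (hf : MemLp f 2 μ) (hf0 : ∫ x, f x ∂μ = 0) :
    Tendsto (fun σ : ℝ => ∫ ω, ‖(P[fun ω => f (u ω) | observedSigma u τ σ]) ω‖ ^ 2 ∂P) atTop
      (𝓝 0) := by
  have hshift : Tendsto (fun σ : ℝ => ∫ x, gaussianShift (σ⁻¹ • x) ∂μ) atTop (𝓝 0) := by
    have h := tendsto_integral_filter_of_dominated_convergence (μ := μ) (l := (atTop : Filter ℝ))
      (F := fun σ x => gaussianShift (σ⁻¹ • x)) (f := fun _ => (0 : ℝ)) (fun _ => 2)
      (Eventually.of_forall fun σ => ?_)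
      (Eventually.of_forall fun σ => ae_of_all _ fun x => ?_) (integrable_const _)
      (ae_of_all _ fun x => ?_)
    · simpa only [integral_zero] using h
    · exact (stronglyMeasurable_gaussianShift.comp_measurable
        (measurable_const_smul _)).aestronglyMeasurable
    · rw [Real.norm_of_nonneg (gaussianShift_nonneg _)]; exact gaussianShift_le_two _
    · refine tendsto_gaussianShift.comp ?_
      simpa using (tendsto_inv_atTop_zero (𝕜 := ℝ)).smul_const x
  refine tendsto_order.2 ⟨fun b hb => Eventually.of_forall fun σ =>
    hb.trans_le (integral_nonneg fun ω => by positivity), fun b hb => ?_⟩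
  obtain ⟨g, hg, hg2⟩ := exists_boundedContinuous_integral_norm_sub_sq_le hf
    (show 0 < b / 16 by positivity)
  have hgi := hg2.integrable one_le_two
  -- centring `g` costs at most as much again, since `f` is centred
  set c := ∫ x, g x ∂μ with hc
  have hc2 : ‖c‖ ^ 2 ≤ b / 16 := by
    have h := norm_integral_sq_le (hf.sub hg2)
    simp only [Pi.sub_apply] at h
    rw [integral_sub (hf.integrable one_le_two) hgi, hf0, zero_sub, norm_neg] at h
    exact h.trans hg
  have hg' : MemLp (fun x => g x - c) 2 μ := hg2.sub (memLp_const c)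
  have hd : ∫ x, ‖f x - (g x - c)‖ ^ 2 ∂μ ≤ b / 4 := by
    have h := integral_norm_add_sq_le (hf.sub hg2) (memLp_const (μ := μ) c)
    rw [integral_const, probReal_univ, one_smul] at h
    have h' : ∀ x, f x - (g x - c) = (f - g) x + c := fun x => by
      simp only [Pi.sub_apply]; abel
    simp_rw [h']
    have h'' : ∫ x, ‖(f - g) x‖ ^ 2 ∂μ ≤ b / 16 := hg
    linarith
  have hC : ∀ x, ‖g x - c‖ ≤ ‖g‖ + ‖c‖ := fun x =>
    (norm_sub_le _ _).trans (add_le_add (g.norm_coe_le_norm _) le_rfl)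
  have h0 : ∫ x, (g x - c) ∂μ = 0 := by
    rw [integral_sub hgi (integrable_const _), integral_const, probReal_univ, one_smul, ← hc,
      sub_self]
  have hlim := (hshift.const_mul (‖g‖ + ‖c‖)).const_mul (‖g‖ + ‖c‖)
  rw [mul_zero, mul_zero] at hlim
  filter_upwards [hlim.eventually_lt_const (show 0 < b / 8 by positivity), eventually_gt_atTop 0]
    with σ hσ hσ0
  have h1 := H.integral_norm_condExp_sq_le_gaussianShift (g := fun x => g x - c)
    (g.continuous.measurable.sub measurable_const) hC h0 hσ0.ne'
  have hfg := hf.sub hg'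
  have h2 := integral_norm_condExp_sq_le (H.comap_le σ) (H.memLp_signal hfg)
  rw [H.integral_signal (f := fun x => ‖(f - fun x => g x - c) x‖ ^ 2)
    (integrable_norm_sq_of_memLp_two hfg).1] at h2
  have h3 := integral_norm_add_sq_le
    ((H.memLp_signal hfg).condExp (m := observedSigma u τ σ) one_le_two)
    ((H.memLp_signal hg').condExp (m := observedSigma u τ σ) one_le_two)
  have h4 : ∫ ω, ‖(P[fun ω => f (u ω) | observedSigma u τ σ]) ω‖ ^ 2 ∂P
      = ∫ ω, ‖(P[fun ω => (f - fun x => g x - c) (u ω) | observedSigma u τ σ]) ω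
        + (P[fun ω => g (u ω) - c | observedSigma u τ σ]) ω‖ ^ 2 ∂P := by
    refine integral_congr_ae ?_
    have h5 := condExp_add ((H.memLp_signal hfg).integrable one_le_two)
      ((H.memLp_signal hg').integrable one_le_two) (observedSigma u τ σ)
    have h6 : (fun ω => (f - fun x => g x - c) (u ω)) + (fun ω => g (u ω) - c)
        = fun ω => f (u ω) := by
      ext ω; simp
    rw [h6] at h5
    filter_upwards [h5] with ω hω
    rw [hω, Pi.add_apply]
  rw [h4]
  simp only [Pi.sub_apply] at h2 h3 ⊢
  linarith

end GaussianChannel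

end ChannelEstimates

/-! ### The linear model with a prior -/

section Model

variable {n d : ℕ} (X : Matrix (Fin n) (Fin d) ℝ) (π : Measure (EuclideanSpace ℝ (Fin d)))

lemma measurable_toEuclideanLin : Measurable (fun θ => X.toEuclideanLin θ) :=
  X.toEuclideanLin.continuous_of_finiteDimensional.measurable

lemma memLp_id_map_toEuclideanLin (hn : 1 ≤ n) (hV : Integrable (signalSq X) π) :
    MemLp (fun x => x) 2 (π.map fun θ => X.toEuclideanLin θ) := by
  have hn0 : (n : ℝ) ≠ 0 := by positivity
  have hm := measurable_toEuclideanLin X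
  refine (memLp_map_measure_iff (by fun_prop) hm.aemeasurable).2 ?_
  refine (memLp_two_iff_integrable_sq_norm hm.aestronglyMeasurable).2 ?_
  refine (hV.const_mul (n : ℝ)).congr (ae_of_all _ fun θ => ?_)
  simp only [signalSq]
  field_simp

lemma memLp_score_map_toEuclideanLin (hn : 1 ≤ n) {p : EuclideanSpace ℝ (Fin n) → ℝ}
    (hJ : Integrable (scoreSq X p) π) :
    MemLp (score p) 2 (π.map fun θ => X.toEuclideanLin θ) := by
  have hn0 : (n : ℝ) ≠ 0 := by positivity
  have hm := measurable_toEuclideanLin X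
  have hs := measurable_score p
  refine (memLp_map_measure_iff hs.aestronglyMeasurable hm.aemeasurable).2 ?_
  refine (memLp_two_iff_integrable_sq_norm (hs.comp hm).aestronglyMeasurable).2 ?_
  refine (hJ.const_mul (n : ℝ)).congr (ae_of_all _ fun θ => ?_)
  simp only [scoreSq, score, Function.comp_apply]
  field_simp

lemma integral_norm_sq_map_toEuclideanLin (hn : 1 ≤ n) :
    ∫ x, ‖x‖ ^ 2 ∂(π.map fun θ => X.toEuclideanLin θ) = n * varParam X π := by
  have hn0 : (n : ℝ) ≠ 0 := by positivity
  rw [integral_map (measurable_toEuclideanLin X).aemeasurable (by fun_prop), varParam,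
    ← integral_const_mul]
  simp only [signalSq]
  field_simp

lemma integral_norm_score_sq_map_toEuclideanLin (hn : 1 ≤ n)
    (p : EuclideanSpace ℝ (Fin n) → ℝ) :
    ∫ x, ‖score p x‖ ^ 2 ∂(π.map fun θ => X.toEuclideanLin θ) = n * fisherInfo X π p := by
  have hn0 : (n : ℝ) ≠ 0 := by positivity
  have hs := measurable_score p
  rw [integral_map (measurable_toEuclideanLin X).aemeasurable
    (hs.norm.pow_const 2).aestronglyMeasurable, fisherInfo, ← integral_const_mul]
  simp only [scoreSq, score]
  field_simp

lemma integral_id_map_toEuclideanLin (hπ : Integrable (fun θ => θ) π)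
    (hmean : ∫ θ, θ ∂π = 0) : ∫ x, x ∂(π.map fun θ => X.toEuclideanLin θ) = 0 := by
  rw [integral_map (measurable_toEuclideanLin X).aemeasurable (by fun_prop)]
  have h := X.toEuclideanLin.toContinuousLinearMap.integral_comp_comm hπ
  rw [hmean, map_zero] at h
  exact h

variable [IsProbabilityMeasure π]

lemma gaussianChannel_model :
    GaussianChannel (model n π) (fun ω => X.toEuclideanLin ω.1) Prod.snd
      (π.map fun θ => X.toEuclideanLin θ) where
  measurable_signal := (measurable_toEuclideanLin X).comp measurable_fst
  measurable_noise := measurable_snd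
  map_eq := by
    have h := Measure.map_prod_map π (stdGaussian (EuclideanSpace ℝ (Fin n)))
      (measurable_toEuclideanLin X) measurable_id
    rw [Measure.map_id] at h
    exact h.symm

lemma toEuclideanLin_bayesEstimator (hπ : Integrable (fun θ => θ) π) (σ : ℝ) :
    (fun ω => X.toEuclideanLin (bayesEstimator X π σ (response X σ ω))) =ᵐ[model n π]
      (model n π)[fun ω => X.toEuclideanLin ω.1 |
        observedSigma (fun ω => X.toEuclideanLin ω.1) Prod.snd σ] := by
  have hY : Measurable (response X σ) := (gaussianChannel_model X π).measurable_observe σ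
  have hfst : Integrable Prod.fst (model n π) := hπ.comp_fst _
  have h1 := condExp_ae_eq_integral_condDistrib' hY hfst
  have h2 := X.toEuclideanLin.toContinuousLinearMap.comp_condExp_comm
    (m := observedSigma (fun ω => X.toEuclideanLin ω.1) Prod.snd σ) hfst
  filter_upwards [h1, h2] with ω h3 h4
  refine Eq.trans ?_ h4
  rw [bayesEstimator, ← h3]
  rfl

/-- The residual of the Bayes estimator is `-σ` times the posterior mean of the noise. -/
lemma trainError_bayesEstimator (hπ : Integrable (fun θ => θ) π)
    (hu : MemLp (fun x => x) 2 (π.map fun θ => X.toEuclideanLin θ)) (σ : ℝ) :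
    trainError X π σ (bayesEstimator X π σ) = (1 / (n : ℝ)) * (σ ^ 2 *
      ∫ ω, ‖((model n π)[Prod.snd |
        observedSigma (fun ω => X.toEuclideanLin ω.1) Prod.snd σ]) ω‖ ^ 2 ∂(model n π)) := by
  have := Measure.isProbabilityMeasure_map (μ := π) (measurable_toEuclideanLin X).aemeasurable
  rw [trainError, integral_const_mul, ← integral_const_mul (σ ^ 2)]
  congr 1
  refine integral_congr_ae ?_
  filter_upwards [toEuclideanLin_bayesEstimator X π hπ σ,
    (gaussianChannel_model X π).condExp_signal_sub_observe hu σ] with ω h1 h2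
  have h3 : X.toEuclideanLin (bayesEstimator X π σ (response X σ ω)) - response X σ ω
      = -(σ • ((model n π)[Prod.snd |
        observedSigma (fun ω => X.toEuclideanLin ω.1) Prod.snd σ]) ω) := by
    rw [h1]; exact h2
  rw [h3, norm_neg, norm_smul, mul_pow, Real.norm_eq_abs, sq_abs]

end Model

end BayesTrain

end

theorem theorem1 {n d : ℕ} (hn : 1 ≤ n) (hnd : n ≤ d)
    (X : Matrix (Fin n) (Fin d) ℝ) (hX : X.rank = n)
    -- the prior, with mean zero
    (π : Measure (EuclideanSpace ℝ (Fin d))) [IsProbabilityMeasure π]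
    (hπ : Integrable (fun θ => θ) π) (hmean : ∫ θ, θ ∂π = 0)
    -- `p` is the density of `X θ`; it is positive and differentiable
    (p : EuclideanSpace ℝ (Fin n) → ℝ) (hp : ∀ y, 0 < p y) (hpd : Differentiable ℝ p)
    (hdens : π.map (fun θ => X.toEuclideanLin θ) =
      volume.withDensity (fun y => ENNReal.ofReal (p y)))
    -- the two parameters of the prior are positive and finite
    (hJfin : Integrable (BayesTrain.scoreSq X p) π) (hJpos : 0 < BayesTrain.fisherInfo X π p)
    (hVfin : Integrable (BayesTrain.signalSq X) π) (hVpos : 0 < BayesTrain.varParam X π) :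
    (∀ σ : ℝ, 0 < σ →
      σ ^ 4 / (BayesTrain.varParam X π + σ ^ 2)
          ≤ BayesTrain.trainError X π σ (BayesTrain.bayesEstimator X π σ) ∧
        BayesTrain.trainError X π σ (BayesTrain.bayesEstimator X π σ)
          ≤ σ ^ 4 / ((BayesTrain.fisherInfo X π p)⁻¹ + σ ^ 2)) ∧
    ((fun σ : ℝ => BayesTrain.trainError X π σ (BayesTrain.bayesEstimator X π σ)
          - σ ^ 4 / ((BayesTrain.fisherInfo X π p)⁻¹ + σ ^ 2))
        =o[𝓝[>] 0] (fun σ : ℝ => σ ^ 4)) ∧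
    ((fun σ : ℝ => BayesTrain.trainError X π σ (BayesTrain.bayesEstimator X π σ)
          - BayesTrain.fisherInfo X π p * σ ^ 4)
        =o[𝓝[>] 0] (fun σ : ℝ => σ ^ 4)) ∧
    ((fun σ : ℝ => BayesTrain.trainError X π σ (BayesTrain.bayesEstimator X π σ)
          - σ ^ 4 / (BayesTrain.varParam X π + σ ^ 2))
        =o[atTop] (fun _ : ℝ => (1 : ℝ))) ∧
    ((fun σ : ℝ => BayesTrain.trainError X π σ (BayesTrain.bayesEstimator X π σ)
          - (σ ^ 2 - BayesTrain.varParam X π))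
        =o[atTop] (fun _ : ℝ => (1 : ℝ))) := by
  have hn0 : (0 : ℝ) < n := by positivity
  have := Measure.isProbabilityMeasure_map (μ := π)
    (BayesTrain.measurable_toEuclideanLin X).aemeasurable
  have H := BayesTrain.gaussianChannel_model X π
  have hu := BayesTrain.memLp_id_map_toEuclideanLin X π hn hVfin
  have hs := BayesTrain.memLp_score_map_toEuclideanLin X π hn hJfin
  have hVint := BayesTrain.integral_norm_sq_map_toEuclideanLin X π hn
  have hJint := BayesTrain.integral_norm_score_sq_map_toEuclideanLin X π hn p
  have hu0 := BayesTrain.integral_id_map_toEuclideanLin X π hπ hmean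
  have hrank : (Module.finrank ℝ (EuclideanSpace ℝ (Fin n)) : ℝ) = n := by simp
  set J := BayesTrain.fisherInfo X π p
  set V := BayesTrain.varParam X π
  let T : ℝ → ℝ := fun σ => BayesTrain.trainError X π σ (BayesTrain.bayesEstimator X π σ)
  have htrain : ∀ σ, T σ = _ := BayesTrain.trainError_bayesEstimator X π hπ hu
  -- `T σ / σ ^ 4` is the mean squared posterior mean of the score
  have hsmall : Tendsto (fun σ => T σ / σ ^ 4) (𝓝[>] 0) (𝓝 J) := by
    have h := ((H.tendsto_integral_norm_condExp_sq_zero hs).const_mul (1 / (n : ℝ))).mono_left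
      (nhdsWithin_le_nhds (s := Set.Ioi (0 : ℝ)))
    rw [hJint, ← mul_assoc, one_div_mul_cancel hn0.ne', one_mul] at h
    refine h.congr' ?_
    filter_upwards [self_mem_nhdsWithin] with σ hσ
    have hσ0 : σ ≠ 0 := (Set.mem_Ioi.1 hσ).ne'
    rw [htrain, H.integral_norm_condExp_noise_sq_eq_score hp hpd hdens hs hσ0]
    field_simp
  -- `T σ - (σ ^ 2 - V)` is the mean squared posterior mean of the signal
  have hlarge : Tendsto (fun σ => T σ - (σ ^ 2 - V)) atTop (𝓝 0) := by
    have h := (H.tendsto_integral_norm_condExp_sq_atTop hu hu0).const_mul (1 / (n : ℝ))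
    rw [mul_zero] at h
    refine h.congr fun σ => ?_
    rw [htrain, H.sq_mul_integral_norm_condExp_noise_sq hu, hVint, hrank]
    field_simp
    ring
  have hlittle : ∀ f : ℝ → ℝ, Tendsto (fun σ => f σ / σ ^ 4) (𝓝[>] 0) (𝓝 J) →
      (fun σ => T σ - f σ) =o[𝓝[>] 0] (fun σ : ℝ => σ ^ 4) := fun f hf => by
    refine (isLittleO_iff_tendsto' ?_).2 ?_
    · filter_upwards [self_mem_nhdsWithin] with σ hσ h0
      exact absurd h0 (pow_ne_zero 4 (Set.mem_Ioi.1 hσ).ne')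
    · simp_rw [sub_div]
      simpa using hsmall.sub hf
  refine ⟨fun σ hσ => ⟨?_, ?_⟩, hlittle _ ?_, hlittle _ ?_, ?_, ?_⟩
  · -- the multiple `c = σ / (V + σ ^ 2)` is the linear regression coefficient of the noise
    change _ ≤ T σ
    rw [htrain]
    have h := H.le_integral_norm_condExp_noise_sq hu σ (σ / (V + σ ^ 2))
    rw [hVint, hrank] at h
    refine le_trans (le_of_eq ?_) (mul_le_mul_of_nonneg_left
      (mul_le_mul_of_nonneg_left h (sq_nonneg σ)) (by positivity))
    have : V + σ ^ 2 ≠ 0 := by positivity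
    field_simp
    ring
  · -- `a = 1 / (1 + σ ^ 2 J)` minimizes the bound
    change T σ ≤ _
    rw [htrain]
    have h := H.integral_norm_condExp_noise_sq_le hp hpd hdens hs hσ.ne' (1 / (1 + σ ^ 2 * J))
    rw [hJint, hrank] at h
    refine le_trans (mul_le_mul_of_nonneg_left
      (mul_le_mul_of_nonneg_left h (sq_nonneg σ)) (by positivity)) (le_of_eq ?_)
    have h1 : 1 + σ ^ 2 * J ≠ 0 := by positivity
    have h2 : J⁻¹ + σ ^ 2 = (1 + σ ^ 2 * J) / J := by field_simp
    rw [h2]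
    field_simp
    ring
  · have h : Tendsto (fun σ : ℝ => (J⁻¹ + σ ^ 2)⁻¹) (𝓝[>] 0) (𝓝 J) := by
      have hc : ContinuousAt (fun σ : ℝ => (J⁻¹ + σ ^ 2)⁻¹) 0 := by
        refine ContinuousAt.inv₀ (by fun_prop) ?_
        positivity
      have := hc.tendsto.mono_left (nhdsWithin_le_nhds (s := Set.Ioi (0 : ℝ)))
      simpa using this
    refine h.congr' ?_
    filter_upwards [self_mem_nhdsWithin] with σ hσ
    have hσ0 : σ ^ 4 ≠ 0 := pow_ne_zero 4 (Set.mem_Ioi.1 hσ).ne'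
    rw [div_right_comm, div_self hσ0, one_div]
  · refine tendsto_const_nhds.congr' ?_
    filter_upwards [self_mem_nhdsWithin] with σ hσ
    rw [mul_div_cancel_right₀ _ (pow_ne_zero 4 (Set.mem_Ioi.1 hσ).ne')]
  · refine (isLittleO_one_iff ℝ).2 ?_
    have h : Tendsto (fun σ : ℝ => V ^ 2 / (V + σ ^ 2)) atTop (𝓝 0) :=
      Tendsto.div_atTop tendsto_const_nhds
        (tendsto_atTop_add_const_left _ _ (tendsto_pow_atTop two_ne_zero))
    have h' := hlarge.sub h
    rw [sub_zero] at h'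
    refine h'.congr fun σ => ?_
    have : V + σ ^ 2 ≠ 0 := by positivity
    field_simp
    ring
  · exact (isLittleO_one_iff ℝ).2 hlarge
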